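/- **Proposition.** Assume that there is a proper class of cardinals $\mu$ with $\mu^{<\mu}=\mu$. Let $\mathcal K$ be an accessible category with all directed colimits that is large (not equivalent to a small category) and satisfies the amalgamation property (any span $L\leftarrow K\to M$ can be completed to a commutative square) and the joint embedding property (any two objects admit morphisms to a common object). Let $U:\mathcal K\to\mathbf{Set}$ be a faithful functor preserving directed colimits. Assume that every morphism of $\mathcal K$ is a monomorphism and is sent by $U$ to an injective map, and that $(\mathcal K,U)$ is coherent: whenever $h:A\to C$ and $g:B\to C$ are morphisms of $\mathcal K$ and $f:UA\to UB$ is a map with $U(g)\circ f=U(h)$, there is a morphism $\overline f:A\to B$ with $U(\overline f)=f$. Then there is a cardinal $\lambda_0$ (depending on $(\mathcal K,U)$) such that for every regular cardinal $\lambda\ge\lambda_0$ and every object $K$ of $\mathcal K$, $K$ is $\lambda$-Galois saturated if and only if $K$ is $\lambda$-saturated. Here $K$ is *$\lambda$-saturated* if for all morphisms $g:A\to B$ and $f:A\to K$ with $A$ and $B$ $\lambda$-presentable there is a morphism $h:B\to K$ with $hg=f$. A *type* over an object $M$ is a pair $(f,a)$ with $f:M\to N$ a morphism and $a\in UN$;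 types $(f_0,a_0)$ and $(f_1,a_1)$ over $M$, with $f_i:M\to N_i$, are *equivalent* if there are morphisms $h_0:N_0\to N$ and $h_1:N_1\to N$ with $h_0f_0=h_1f_1$ and $U(h_0)(a_0)=U(h_1)(a_1)$. The object $K$ is *$\lambda$-Galois saturated* if for every morphism $g:M\to K$ with $M$ $\lambda$-presentable and every type $(f,a)$ over $M$ there is $b\in UK$ such that $(f,a)$ and $(g,b)$ are equivalent. -/

import Mathlib

open CategoryTheory CategoryTheory.Limits

universe w u

namespace ConcreteAccessible

section Categorical

variable (C : Type u) [Category.{w} C]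

/-- The amalgamation property: any span `L ← K → M` can be completed to a commutative square. -/
def HasAmalgamation : Prop :=
  ∀ ⦃K L M : C⦄ (f : K ⟶ L) (g : K ⟶ M),
    ∃ (N : C) (f' : L ⟶ N) (g' : M ⟶ N), f ≫ f' = g ≫ g'

/-- The joint embedding property: any two objects map to a common object. -/
def HasJointEmbedding : Prop :=
  ∀ K L : C, ∃ N : C, Nonempty (K ⟶ N) ∧ Nonempty (L ⟶ N)

variable {C}

/-- `K` is `κ`-saturated: it is injective with respect to all morphisms between
`κ`-presentable objects. -/
def IsSaturated (κ : Cardinal.{w}) [Fact κ.IsRegular] (K : C) : Prop :=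
  ∀ ⦃A B : C⦄, IsCardinalPresentable A κ → IsCardinalPresentable B κ →
    ∀ (g : A ⟶ B) (f : A ⟶ K), ∃ h : B ⟶ K, g ≫ h = f

end Categorical

section Concrete

variable {C : Type u} [Category.{w} C] (U : C ⥤ Type w)

/-- Coherence of `(C, U)`: a map of underlying sets `f : U A → U B` such that `U g ∘ f = U h` for
some morphisms `h : A ⟶ D` and `g : B ⟶ D` underlies a morphism `A ⟶ B`. -/
def IsCoherent : Prop :=
  ∀ ⦃A B D : C⦄ (h : A ⟶ D) (g : B ⟶ D) (f : U.obj A ⟶ U.obj B),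
    f ≫ U.map g = U.map h → ∃ f' : A ⟶ B, U.map f' = f

/-- All morphisms are concrete monomorphisms, i.e. monomorphisms which are preserved by `U`. -/
def MorphismsAreConcreteMonos : Prop :=
  ∀ ⦃A B : C⦄ (f : A ⟶ B), Mono f ∧ Mono (U.map f)

/-- A type over `M`: a pair `(f, a)` of a morphism `f : M ⟶ N` and an element `a` of `U N`. -/
structure TypeOver (M : C) where
  /-- the codomain `N` -/
  cod : C
  /-- the morphism `f : M ⟶ N` -/
  hom : M ⟶ cod
  /-- the element `a` of `U N` -/
  elt : U.obj cod

variable {U}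

/-- Two types `(f₀, a₀)` and `(f₁, a₁)` over `M` are equivalent if there are morphisms
`h₀ : N₀ ⟶ N` and `h₁ : N₁ ⟶ N` with `h₀ f₀ = h₁ f₁` and `U h₀ (a₀) = U h₁ (a₁)`. -/
def TypeOver.Equivalent {M : C} (p q : TypeOver U M) : Prop :=
  ∃ (N : C) (h₀ : p.cod ⟶ N) (h₁ : q.cod ⟶ N),
    p.hom ≫ h₀ = q.hom ≫ h₁ ∧ U.map h₀ p.elt = U.map h₁ q.elt

variable (U)

/-- `K` is `κ`-Galois saturated: for every morphism `g : M ⟶ K` with `M` `κ`-presentable and every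
type `(f, a)` over `M` there is `b ∈ U K` such that `(f, a)` and `(g, b)` are equivalent. -/
def IsGaloisSaturated (κ : Cardinal.{w}) [Fact κ.IsRegular] (K : C) : Prop :=
  ∀ ⦃M : C⦄, IsCardinalPresentable M κ → ∀ (g : M ⟶ K) (p : TypeOver U M),
    ∃ b : U.obj K, p.Equivalent ⟨K, g, b⟩

end Concrete

end ConcreteAccessible

/-!
Morphisms of `C` are determined by their underlying maps and, by coherence, a morphism into `X`
factors through `g : B ⟶ X` as soon as its image is contained in that of `g`
(`IsCoherent.exists_lift`). So the subobjects of `X` behave like subsets of `U X`.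

*Small hulls.* Write `X` as a colimit, over a directed poset `J`, of objects from a fixed small set
of presentable objects. For regular `κ` above a bound `κ₀`, a subset `S` of `U X` with fewer than
`κ` elements lies in the image of a `κ`-presentable `Y` with `|U Y| < κ`: choose a monotone map from
the finite subsets of `S` to `J` and let `Y` be the colimit along it
(`exists_forall_hasSmallHulls`). No comparison of `κ` with the index of accessibility beyond
`κ₀ ≤ κ` is needed, because `C` has all directed colimits. Moreover, every object is the
`κ`-directed colimit of its subobjects with fewer than `κ` elements, so a `κ`-presentable object
has fewer than `κ` elements (`HasSmallHulls.hasCardinalLT_of_isCardinalPresentable`).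

*Saturated implies Galois saturated.* Given a type `(f : M ⟶ N, a)`, map a small hull of
`f(M) ∪ {a}` to `K` over `M`, and amalgamate `N` and `K` over the hull.

*Galois saturated implies saturated.* Given `g : A ⟶ B` and `f : A ⟶ K`, consider the diagrams
`K ⟵ N ⟶ D ⟵ B`, starting with `N = A` and `D = B`. If `N` is `κ`-presentable and `b ∈ U B`, then
the type of `b` over `N` is realized in `K`; taking the amalgam as new `D`, and a small hull of `N`
and of the realization as new `N`, the image of `b` in `D` comes to lie in the image of `N`
(`PartialEmbedding.exists_realizing`). Iterating transfinitely along `κ`, with colimits at limit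
stages, `N` stays `κ`-presentable at each stage before `κ`, and as `|U B| < κ` the elements of `B`
are exhausted before `κ` (`PartialEmbedding.exists_realized_eq_univ`). Then `B ⟶ D` factors
through `N ⟶ D` by coherence, and the composition `B ⟶ N ⟶ K` extends `f`.
-/

namespace ConcreteAccessible

/-! ### Finite subsets and directed orders -/

/-- A family in a directed preorder is dominated by a monotone function of finite subsets of its
index set: `F S` is chosen above `s t` for `t ∈ S` and above `F R` for the proper subsets `R` of
`S`. -/
lemma exists_monotone_finset {T J : Type*} [Preorder J] [IsDirectedOrder J] [Nonempty J]
    (s : T → J) : ∃ F : Finset T → J, Monotone F ∧ ∀ t, s t ≤ F {t} := by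
  classical
  choose ub hub using fun S : Finset J ↦ Finset.exists_le S
  let F : Finset T → J := Finset.strongInduction fun S G ↦
    ub (S.ssubsets.attach.image (fun R ↦ G R.1 (Finset.mem_ssubsets.1 R.2)) ∪ S.image s)
  have hF (S : Finset T) : F S = ub (S.ssubsets.attach.image (fun R ↦ F R.1) ∪ S.image s) :=
    Finset.strongInduction_eq _ _
  refine ⟨F, fun S R hSR ↦ ?_, fun t ↦ ?_⟩
  · obtain rfl | h := hSR.eq_or_ssubset
    · exact le_rfl
    · rw [hF R]
      refine hub _ _ (Finset.mem_union_left _ (Finset.mem_image.2 ?_))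
      exact ⟨⟨S, Finset.mem_ssubsets.2 h⟩, Finset.mem_attach _ _, rfl⟩
  · rw [hF {t}]
    exact hub _ _ (Finset.mem_union_right _ (by simp))

lemma hasCardinalLT_finset {T : Type w} {κ : Cardinal.{w}} (hκ : Cardinal.aleph0 < κ)
    (hT : HasCardinalLT T κ) : HasCardinalLT (Finset T) κ := by
  rw [hasCardinalLT_iff_cardinal_mk_lt] at hT ⊢
  cases finite_or_infinite T
  · exact (Cardinal.mk_lt_aleph0_iff.2 inferInstance).trans hκ
  · rwa [Cardinal.mk_finset_of_infinite]

lemma hasCardinalLT_arrow_of_preorder {J : Type w} [Preorder J] {κ : Cardinal.{w}}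
    (hκ : Cardinal.aleph0 ≤ κ) (hJ : HasCardinalLT J κ) : HasCardinalLT (Arrow J) κ :=
  (hasCardinalLT_prod hκ hJ hJ).of_injective (fun f ↦ (f.left, f.right)) (by
    rintro ⟨a, b, f⟩ ⟨a', b', f'⟩ h
    obtain ⟨rfl, rfl⟩ := Prod.mk.inj h
    obtain rfl : f = f' := Subsingleton.elim _ _
    rfl)

/-! ### Lifting along concrete monomorphisms -/

variable {C : Type u} [Category.{w} C] {U : C ⥤ Type w}

lemma map_comp_apply {A B D : C} (f : A ⟶ B) (g : B ⟶ D) (a : U.obj A) :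
    U.map (f ≫ g) a = U.map g (U.map f a) := by
  rw [U.map_comp, ConcreteCategory.comp_apply]

lemma MorphismsAreConcreteMonos.injective (hmono : MorphismsAreConcreteMonos U) {A B : C}
    (f : A ⟶ B) : Function.Injective (U.map f) :=
  (mono_iff_injective _).1 (hmono f).2

/-- Coherence in terms of images: a morphism whose image is contained in that of `g` factors
through `g`. -/
lemma IsCoherent.exists_lift [U.Faithful] (hcoh : IsCoherent U) {A B D : C} (h : A ⟶ D)
    (g : B ⟶ D) (hr : Set.range (U.map h) ⊆ Set.range (U.map g)) : ∃ f : A ⟶ B, f ≫ g = h := by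
  choose f hf using fun a ↦ hr ⟨a, rfl⟩
  have hfg : (↾f) ≫ U.map g = U.map h := by
    ext a
    exact hf a
  obtain ⟨f', hf'⟩ := hcoh h g (↾f) hfg
  exact ⟨f', U.map_injective (by rw [U.map_comp, hf', hfg])⟩

lemma IsCoherent.isIso_of_surjective [U.Faithful] (hcoh : IsCoherent U)
    (hmono : MorphismsAreConcreteMonos U) {A B : C} (f : A ⟶ B)
    (hf : Function.Surjective (U.map f)) : IsIso f := by
  obtain ⟨g, hg⟩ := hcoh.exists_lift (𝟙 B) f (by simp [hf.range_eq])
  have := (hmono f).1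
  exact ⟨g, by rw [← cancel_mono f, Category.assoc, hg, Category.comp_id, Category.id_comp], hg⟩

/-! ### Small hulls -/

variable (U) in
/-- Every set of fewer than `κ` elements of an object `X` is contained in the image of a morphism
`Y ⟶ X` where `Y` is `κ`-presentable and has fewer than `κ` elements (a downward
Löwenheim-Skolem property). -/
def HasSmallHulls (κ : Cardinal.{w}) [Fact κ.IsRegular] : Prop :=
  ∀ (X : C) (S : Set (U.obj X)), HasCardinalLT S κ →
    ∃ (Y : C) (i : Y ⟶ X), IsCardinalPresentable Y κ ∧ HasCardinalLT (U.obj Y) κ ∧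
      S ⊆ Set.range (U.map i)

lemma hasCardinalLT_of_isColimit {J : Type w} [SmallCategory J] {F : J ⥤ C}
    [PreservesColimit F U] {c : Cocone F} (hc : IsColimit c) {κ : Cardinal.{w}}
    [Fact κ.IsRegular] (hJ : HasCardinalLT J κ) (hF : ∀ j, HasCardinalLT (U.obj (F.obj j)) κ) :
    HasCardinalLT (U.obj c.pt) κ :=
  (hasCardinalLT_sigma (fun j ↦ U.obj (F.obj j)) κ hJ hF).of_surjective
    (fun x ↦ U.map (c.ι.app x.1) x.2) (fun y ↦ by
      obtain ⟨j, x, hx⟩ := Types.jointly_surjective_of_isColimit (isColimitOfPreserves U hc) y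
      exact ⟨⟨j, x⟩, hx⟩)

/-- Small hulls in a directed colimit of small `κ`-presentable objects. The index poset need not be
`κ`-directed: the hull is itself a directed colimit, indexed by the finite subsets of `S`. -/
lemma exists_small_hull [HasFilteredColimitsOfSize.{w, w} C]
    [PreservesFilteredColimitsOfSize.{w, w} U] {κ : Cardinal.{w}} [Fact κ.IsRegular]
    (hκ : Cardinal.aleph0 < κ) {J : Type w} [Preorder J] [IsDirectedOrder J] [Nonempty J]
    {F : J ⥤ C} {c : Cocone F} (hc : IsColimit c)
    (hp : ∀ j, IsCardinalPresentable (F.obj j) κ) (hF : ∀ j, HasCardinalLT (U.obj (F.obj j)) κ)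
    (S : Set (U.obj c.pt)) (hS : HasCardinalLT S κ) :
    ∃ (Y : C) (i : Y ⟶ c.pt), IsCardinalPresentable Y κ ∧ HasCardinalLT (U.obj Y) κ ∧
      S ⊆ Set.range (U.map i) := by
  classical
  choose a x hx using fun s : S ↦
    Types.jointly_surjective_of_isColimit (isColimitOfPreserves U hc) s.1
  obtain ⟨H, hH, hHa⟩ := exists_monotone_finset a
  let D : Finset S ⥤ C := hH.functor ⋙ F
  let i : colimit D ⟶ c.pt := colimit.desc D (c.whisker hH.functor)
  have hfin := hasCardinalLT_finset hκ hS
  have hD (R : Finset S) : IsCardinalPresentable (D.obj R) κ := hp _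
  refine ⟨colimit D, i, ?_, ?_, fun s hs ↦ ?_⟩
  · exact isCardinalPresentable_of_isColimit _ (colimit.isColimit D) κ
      (hasCardinalLT_arrow_of_preorder hκ.le hfin)
  · exact hasCardinalLT_of_isColimit (colimit.isColimit D) hfin (fun _ ↦ hF _)
  · let f : F.obj (a ⟨s, hs⟩) ⟶ D.obj {⟨s, hs⟩} := F.map (homOfLE (hHa ⟨s, hs⟩))
    have hf : (f ≫ colimit.ι D {⟨s, hs⟩}) ≫ i = c.ι.app (a ⟨s, hs⟩) := by
      rw [Category.assoc, colimit.ι_desc]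
      exact c.w _
    refine ⟨U.map (f ≫ colimit.ι D {⟨s, hs⟩}) (x ⟨s, hs⟩), ?_⟩
    rw [← map_comp_apply, hf]
    exact hx ⟨s, hs⟩

variable (U) in
lemma exists_forall_hasSmallHulls [IsAccessibleCategory.{w} C]
    [HasFilteredColimitsOfSize.{w, w} C] [PreservesFilteredColimitsOfSize.{w, w} U] :
    ∃ κ₀ : Cardinal.{w}, ∀ (κ : Cardinal.{w}) [Fact κ.IsRegular], κ₀ ≤ κ →
      HasSmallHulls U κ := by
  obtain ⟨κ', _, _⟩ := IsAccessibleCategory.exists_cardinal C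
  obtain ⟨P, _, hP⟩ := HasCardinalFilteredGenerator.exists_small_generator C κ'
  obtain ⟨μ, -, hμ⟩ := HasCardinalLT.exists_regular_cardinal_forall.{w}
    (fun X : Subtype P ↦ U.obj X.1)
  refine ⟨max (max κ' μ) (Order.succ Cardinal.aleph0), fun κ _ hκ X S hS ↦ ?_⟩
  obtain ⟨J, _, _, ⟨p⟩⟩ := hP.exists_colimitsOfShape X
  have := isFiltered_of_isCardinalFiltered J κ'
  have hκ' : κ' ≤ κ := (le_max_left _ _).trans ((le_max_left _ _).trans hκ)
  obtain ⟨α, _, _, _, G, _⟩ := IsFiltered.exists_directed J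
  refine exists_small_hull (Order.succ_le_iff.1 ((le_max_right _ _).trans hκ))
    ((Functor.Final.isColimitWhiskerEquiv G _).symm p.isColimit) (fun j ↦ ?_) (fun j ↦ ?_) S hS
  · exact isCardinalPresentable_monotone C hκ' _
      (hP.le_isCardinalPresentable _ (p.prop_diag_obj (G.obj j)))
  · exact (hμ ⟨_, p.prop_diag_obj (G.obj j)⟩).of_le
      ((le_max_right _ _).trans ((le_max_left _ _).trans hκ))

/-- The subobjects of `A` with fewer than `κ` elements form a `κ`-directed poset with colimit `A`.
The identity of a `κ`-presentable `A` factors through one of them, which bounds the cardinality of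
`A`. -/
lemma HasSmallHulls.hasCardinalLT_of_isCardinalPresentable [HasFilteredColimitsOfSize.{w, w} C]
    [PreservesFilteredColimitsOfSize.{w, w} U] [U.Faithful] (hcoh : IsCoherent U)
    (hmono : MorphismsAreConcreteMonos U) {κ : Cardinal.{w}} [Fact κ.IsRegular]
    (hU : HasSmallHulls U κ) (A : C) [IsCardinalPresentable A κ] :
    HasCardinalLT (U.obj A) κ := by
  -- Subobjects are represented by their images, which makes them a small poset.
  let 𝓢 := {s : Set (U.obj A) // HasCardinalLT s κ ∧
    ∃ (Y : C) (i : Y ⟶ A), Set.range (U.map i) = s}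
  choose Y i hi using fun s : 𝓢 ↦ s.2.2
  have hle {s t : 𝓢} (h : s ≤ t) : ∃ f : Y s ⟶ Y t, f ≫ i t = i s :=
    hcoh.exists_lift _ _ (by simpa only [hi] using! h)
  choose φ hφ using @hle
  let D : 𝓢 ⥤ C :=
    { obj := Y
      map f := φ (leOfHom f)
      map_id s := by
        have := (hmono (i s)).1
        rw [← cancel_mono (i s), hφ, Category.id_comp]
      map_comp {s t r} f g := by
        have := (hmono (i r)).1
        rw [← cancel_mono (i r), Category.assoc, hφ, hφ, hφ] }
  have hhull (S : Set (U.obj A)) (hS : HasCardinalLT S κ) : ∃ s : 𝓢, S ⊆ s.1 := by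
    obtain ⟨Y, i, -, hY, hi⟩ := hU A S hS
    exact ⟨⟨Set.range (U.map i), hY.of_surjective _ Set.rangeFactorization_surjective, Y, i, rfl⟩,
      hi⟩
  have : IsCardinalFiltered 𝓢 κ := isCardinalFiltered_preorder _ _ fun T s hT ↦ by
    obtain ⟨t, ht⟩ := hhull (⋃ k, (s k).1) (hasCardinalLT_iUnion _
      ((hasCardinalLT_iff_cardinal_mk_lt _ _).2 hT) (fun k ↦ (s k).2.1))
    exact ⟨t, fun k ↦ (Set.subset_iUnion (fun k ↦ (s k).1) k).trans ht⟩
  have := isFiltered_of_isCardinalFiltered 𝓢 κ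
  let c : Cocone D := { pt := A, ι := { app := i, naturality s t f := by simp [D, hφ] } }
  have : IsIso ((colimit.isColimit D).desc c) := hcoh.isIso_of_surjective hmono _ fun a ↦ by
    obtain ⟨s, hs⟩ := hhull {a} (hasCardinalLT_of_finite _ _
      (Cardinal.IsRegular.aleph0_le Fact.out))
    obtain ⟨y, hy⟩ := (hi s).symm.subset (hs rfl)
    refine ⟨U.map ((colimit.cocone D).ι.app s) y, ?_⟩
    rw [← map_comp_apply, (colimit.isColimit D).fac]
    exact hy
  have hc : IsColimit c := IsColimit.ofPointIso (colimit.isColimit D)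
  obtain ⟨s, f, -⟩ := IsCardinalPresentable.exists_hom_of_isColimit κ hc (𝟙 A)
  refine s.2.1.of_injective (fun a ↦ ⟨U.map (i s) (U.map f a), (hi s).subset ⟨_, rfl⟩⟩) ?_
  intro a b h
  exact hmono.injective _ (hmono.injective _ (Subtype.ext_iff.1 h))

/-! ### Saturated objects are Galois saturated -/

lemma IsSaturated.isGaloisSaturated [U.Faithful] (hAP : HasAmalgamation C)
    (hcoh : IsCoherent U) {κ : Cardinal.{w}} [Fact κ.IsRegular]
    (hU : HasSmallHulls U κ)
    (hsmall : ∀ A : C, IsCardinalPresentable A κ → HasCardinalLT (U.obj A) κ)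
    {K : C} (hK : IsSaturated κ K) : IsGaloisSaturated U κ K := by
  intro M hM g p
  have hκ : Cardinal.aleph0 ≤ κ := Cardinal.IsRegular.aleph0_le Fact.out
  obtain ⟨Y, i, hY, -, hi⟩ := hU p.cod (Set.range (U.map p.hom) ∪ {p.elt})
    (hasCardinalLT_union hκ
      ((hsmall M hM).of_surjective _ Set.rangeFactorization_surjective)
      (hasCardinalLT_of_finite _ _ hκ))
  obtain ⟨l, hl⟩ := hcoh.exists_lift p.hom i (Set.subset_union_left.trans hi)
  obtain ⟨a, ha⟩ := hi (Or.inr rfl)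
  obtain ⟨h, hh⟩ := hK hM hY l g
  obtain ⟨N, s, t, hst⟩ := hAP i h
  refine ⟨U.map h a, N, s, t, ?_, ?_⟩
  · dsimp
    rw [← hl, ← hh, Category.assoc, Category.assoc, hst]
  · dsimp
    rw [← ha, ← map_comp_apply, ← map_comp_apply, hst]

/-! ### Partial embeddings -/

/-- Approximations to a morphism `B ⟶ K`: diagrams `K ⟵ N ⟶ D ⟵ B`, encoded as a comma category
so that filtered colimits exist and are computed componentwise. If `B ⟶ D` factors through
`N ⟶ D`, such a diagram yields a morphism `B ⟶ N ⟶ K`. -/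
abbrev PartialEmbedding (B K : C) := Comma (Over.forget K) (Under.forget B)

namespace PartialEmbedding

variable {B K : C}

/-- The object `N` in `K ⟵ N ⟶ D ⟵ B`. -/
abbrev dom (X : PartialEmbedding B K) : C := X.left.left

/-- The object `D` in `K ⟵ N ⟶ D ⟵ B`. -/
abbrev cod (X : PartialEmbedding B K) : C := X.right.right

/-- The morphism `N ⟶ K` in `K ⟵ N ⟶ D ⟵ B`. -/
abbrev toTarget (X : PartialEmbedding B K) : X.dom ⟶ K := X.left.hom

/-- The morphism `N ⟶ D` in `K ⟵ N ⟶ D ⟵ B`. -/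
abbrev emb (X : PartialEmbedding B K) : X.dom ⟶ X.cod := X.hom

/-- The morphism `B ⟶ D` in `K ⟵ N ⟶ D ⟵ B`. -/
abbrev ofSource (X : PartialEmbedding B K) : B ⟶ X.cod := X.right.hom

/-- The partial embedding with given legs. -/
abbrev mk {N D : C} (n : N ⟶ K) (c : N ⟶ D) (b : B ⟶ D) : PartialEmbedding B K :=
  ⟨Over.mk n, Under.mk b, c⟩

/-- A morphism of partial embeddings is a pair of morphisms `N ⟶ N'` and `D ⟶ D'` compatible with
the legs; it is the identity on `K` and `B`. -/
def homMk {X Y : PartialEmbedding B K} (l : X.dom ⟶ Y.dom) (r : X.cod ⟶ Y.cod)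
    (hl : l ≫ Y.toTarget = X.toTarget) (hr : X.ofSource ≫ r = Y.ofSource)
    (h : l ≫ Y.emb = X.emb ≫ r) : X ⟶ Y where
  left := Over.homMk l hl
  right := Under.homMk r hr
  w := h

lemma hom_emb {X Y : PartialEmbedding B K} (φ : X ⟶ Y) :
    φ.left.left ≫ Y.emb = X.emb ≫ φ.right.right := φ.w

variable (U) in
/-- The elements of `B` whose image in `D` comes from `N`. -/
def realized (X : PartialEmbedding B K) : Set (U.obj B) :=
  {b | U.map X.ofSource b ∈ Set.range (U.map X.emb)}

lemma realized_subset {X Y : PartialEmbedding B K} (φ : X ⟶ Y) : X.realized U ⊆ Y.realized U := by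
  rintro b ⟨x, hx⟩
  refine ⟨U.map φ.left.left x, ?_⟩
  have hr : X.ofSource ≫ φ.right.right = Y.ofSource := Under.w φ.right
  rw [← map_comp_apply, hom_emb, map_comp_apply, hx, ← map_comp_apply, hr]

/-- Galois saturation of `K` allows to realize one more element `b` of `B`: the type of `b` over `N`
has a realization `k` in `K`, witnessed by an amalgam of `D` and `K` over `N`. This amalgam is the
new `D`, and a small hull of `N` and `k` in `K` is the new `N`. -/
lemma exists_realizing [U.Faithful] (hcoh : IsCoherent U) {κ : Cardinal.{w}} [Fact κ.IsRegular]
    (hU : HasSmallHulls U κ)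
    (hsmall : ∀ A : C, IsCardinalPresentable A κ → HasCardinalLT (U.obj A) κ)
    (hK : IsGaloisSaturated U κ K) (X : PartialEmbedding B K)
    (hX : IsCardinalPresentable X.dom κ) (b : U.obj B) :
    ∃ (Y : PartialEmbedding B K) (_ : X ⟶ Y), IsCardinalPresentable Y.dom κ ∧
      b ∈ Y.realized U := by
  have hκ : Cardinal.aleph0 ≤ κ := Cardinal.IsRegular.aleph0_le Fact.out
  obtain ⟨k, D, s, t, hst, hk⟩ := hK hX X.toTarget ⟨X.cod, X.emb, U.map X.ofSource b⟩
  dsimp only at s t hst hk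
  obtain ⟨N, n, hN, -, hn⟩ := hU K (Set.range (U.map X.toTarget) ∪ {k})
    (hasCardinalLT_union hκ
      ((hsmall X.dom hX).of_surjective _ Set.rangeFactorization_surjective)
      (hasCardinalLT_of_finite _ _ hκ))
  obtain ⟨l, hl⟩ := hcoh.exists_lift X.toTarget n (Set.subset_union_left.trans hn)
  obtain ⟨a, ha⟩ := hn (Or.inr rfl)
  refine ⟨mk n (n ≫ t) (X.ofSource ≫ s), homMk l s hl rfl ?_, hN, a, ?_⟩
  · change l ≫ n ≫ t = _
    rw [hst, ← hl, Category.assoc]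
  · change U.map (n ≫ t) a = U.map (X.ofSource ≫ s) b
    rw [map_comp_apply, map_comp_apply, ha, hk]

/-- A step defined on all partial embeddings, as transfinite iteration requires: it does nothing
when `N` is not `κ`-presentable or all of `B` is realized. -/
lemma exists_succ [U.Faithful] (hcoh : IsCoherent U) {κ : Cardinal.{w}} [Fact κ.IsRegular]
    (hU : HasSmallHulls U κ)
    (hsmall : ∀ A : C, IsCardinalPresentable A κ → HasCardinalLT (U.obj A) κ)
    (hK : IsGaloisSaturated U κ K) (X : PartialEmbedding B K) :
    ∃ (Y : PartialEmbedding B K) (_ : X ⟶ Y), IsCardinalPresentable X.dom κ →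
      IsCardinalPresentable Y.dom κ ∧
        (X.realized U ≠ Set.univ → ∃ b ∈ Y.realized U, b ∉ X.realized U) := by
  by_cases hX : IsCardinalPresentable X.dom κ
  · by_cases h : X.realized U = Set.univ
    · exact ⟨X, 𝟙 X, fun _ ↦ ⟨hX, fun h' ↦ (h' h).elim⟩⟩
    · obtain ⟨b, hb⟩ := (Set.ne_univ_iff_exists_notMem _).1 h
      obtain ⟨Y, φ, hY, hbY⟩ := exists_realizing hcoh hU hsmall hK X hX b
      exact ⟨Y, φ, fun _ ↦ ⟨hY, fun _ ↦ ⟨b, hbY, hb⟩⟩⟩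
  · exact ⟨X, 𝟙 X, fun h ↦ (hX h).elim⟩

/-! ### Transfinite iteration -/

attribute [local instance] IsFiltered.isConnected

lemma hasIterationOfShape [HasFilteredColimitsOfSize.{w, w} C] (J : Type w) [LinearOrder J]
    [Nonempty J] : HasIterationOfShape J (PartialEmbedding B K) where
  hasColimitsOfShape_of_isSuccLimit j hj := by
    have := hj.nonempty_Iio.to_subtype
    infer_instance

lemma isCardinalPresentable_dom_of_isColimit [HasFilteredColimitsOfSize.{w, w} C]
    {J : Type w} [SmallCategory J] [IsFiltered J] {κ : Cardinal.{w}} [Fact κ.IsRegular]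
    (hJ : HasCardinalLT (Arrow J) κ) {F : J ⥤ PartialEmbedding B K} {c : Cocone F}
    (hc : IsColimit c) (hF : ∀ j, IsCardinalPresentable (F.obj j).dom κ) :
    IsCardinalPresentable c.pt.dom κ := by
  let G := Comma.fst (Over.forget K) (Under.forget B) ⋙ Over.forget K
  have (j : J) : IsCardinalPresentable ((F ⋙ G).obj j) κ := hF j
  exact isCardinalPresentable_of_isColimit _ (isColimitOfPreserves G hc) κ hJ

open SmallObject in
/-- Iterating a step that realizes a new element of `B` whenever there is one left realizes all of
`B` before stage `κ`, since `B` has fewer than `κ` elements. -/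
lemma exists_realized_eq_univ [HasFilteredColimitsOfSize.{w, w} C]
    {κ : Cardinal.{w}} [Fact κ.IsRegular] (hB : HasCardinalLT (U.obj B) κ)
    (hsucc : ∀ X : PartialEmbedding B K, ∃ (Y : PartialEmbedding B K) (_ : X ⟶ Y),
      IsCardinalPresentable X.dom κ → IsCardinalPresentable Y.dom κ ∧
        (X.realized U ≠ Set.univ → ∃ b ∈ Y.realized U, b ∉ X.realized U))
    (X : PartialEmbedding B K) (hX : IsCardinalPresentable X.dom κ) :
    ∃ (Y : PartialEmbedding B K) (_ : X ⟶ Y), Y.realized U = Set.univ := by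
  have hκ : Cardinal.aleph0 ≤ κ := Cardinal.IsRegular.aleph0_le Fact.out
  let J := κ.ord.ToType
  have : NoMaxOrder J := Cardinal.noMaxOrder hκ
  have : Nonempty J := IsCardinalFiltered.nonempty J κ
  let _ : OrderBot J := WellFoundedLT.toOrderBot J
  have := hasIterationOfShape (B := B) (K := K) J
  choose succ toSucc h using hsucc
  let Φ : SuccStruct (PartialEmbedding B K) := ⟨X, succ, toSucc⟩
  let F := Φ.iterationFunctor J
  have hsucc (j : J) : F.obj (Order.succ j) = succ (F.obj j) :=
    (Φ.prop_iterationFunctor_map_succ j (not_isMax j)).succ_eq.symm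
  -- At a limit stage `j`, a colimit of fewer than `κ` many `κ`-presentable objects is taken.
  have hpres (j : J) : IsCardinalPresentable (F.obj j).dom κ := by
    induction j using SuccOrder.limitRecOn with
    | isMin j hj =>
      obtain rfl := hj.eq_bot
      exact (show F.obj ⊥ = X from (Φ.iter ⊥).obj_bot) ▸ hX
    | succ j _ hj =>
      rw [hsucc]
      exact (h _ hj).1
    | isSuccLimit j hj hlt =>
      have := hj.nonempty_Iio.to_subtype
      refine isCardinalPresentable_dom_of_isColimit
        (hasCardinalLT_arrow_of_preorder hκ ?_)
        (F.isColimitOfIsWellOrderContinuous j hj) (fun i ↦ hlt i.1 i.2)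
      rw [hasCardinalLT_iff_cardinal_mk_lt]
      simpa [J] using Cardinal.mk_Iio_lt j (by simp [J])
  by_contra! hne
  have hnew (j : J) : ∃ b ∈ (F.obj (Order.succ j)).realized U, b ∉ (F.obj j).realized U := by
    rw [hsucc]
    exact (h _ (hpres j)).2 (hne _ ((Φ.ιIterationFunctor J).app j))
  -- An element first realized at each stage gives an injection of `κ` into `U B`.
  choose b hb hb' using hnew
  have hinj : Function.Injective b := Function.Injective.of_lt_imp_ne fun i j hij hbij ↦ hb' j <|
    hbij ▸ realized_subset (F.map (homOfLE (Order.succ_le_of_lt hij))) (hb i)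
  have := hB.of_injective b hinj
  simp [hasCardinalLT_iff_cardinal_mk_lt, J] at this

end PartialEmbedding

/-! ### Galois saturated objects are saturated -/

lemma IsGaloisSaturated.isSaturated [HasFilteredColimitsOfSize.{w, w} C] [U.Faithful]
    (hcoh : IsCoherent U) (hmono : MorphismsAreConcreteMonos U) {κ : Cardinal.{w}} [Fact κ.IsRegular]
    (hU : HasSmallHulls U κ)
    (hsmall : ∀ A : C, IsCardinalPresentable A κ → HasCardinalLT (U.obj A) κ)
    {K : C} (hK : IsGaloisSaturated U κ K) : IsSaturated κ K := by
  intro A B hA hB g f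
  obtain ⟨Y, φ, hY⟩ := PartialEmbedding.exists_realized_eq_univ (hsmall B hB)
    (PartialEmbedding.exists_succ hcoh hU hsmall hK) (.mk f g (𝟙 B)) hA
  obtain ⟨u, hu⟩ := hcoh.exists_lift Y.ofSource Y.emb (by
    rintro _ ⟨b, rfl⟩
    exact hY.symm.subset (Set.mem_univ b))
  have := (hmono Y.emb).1
  have hr : 𝟙 B ≫ φ.right.right = Y.ofSource := Under.w φ.right
  have hl : φ.left.left ≫ Y.toTarget = f := Over.w φ.left
  have he : φ.left.left ≫ Y.emb = g ≫ φ.right.right := PartialEmbedding.hom_emb φ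
  have hgu : g ≫ u = φ.left.left := by
    rw [← cancel_mono Y.emb, Category.assoc, hu, he, ← hr, Category.id_comp]
  exact ⟨u ≫ Y.toTarget, by rw [← Category.assoc, hgu, hl]⟩

end ConcreteAccessible

theorem proposition6p2
    -- arbitrarily large cardinals `μ` with `μ^{<μ} = μ`
    (hcard : ∀ κ : Cardinal.{w}, ∃ μ : Cardinal.{w}, κ < μ ∧ Cardinal.powerlt μ μ = μ)
    -- an accessible category with directed colimits, and a faithful functor to sets preserving them
    {C : Type u} [Category.{w} C] [IsAccessibleCategory.{w} C]
    [HasFilteredColimitsOfSize.{w, w} C]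
    (U : C ⥤ Type w) [U.Faithful] [PreservesFilteredColimitsOfSize.{w, w} U]
    -- largeness: not equivalent to a small category
    (hlarge : ¬ EssentiallySmall.{w} C)
    (hAP : ConcreteAccessible.HasAmalgamation C)
    (hJEP : ConcreteAccessible.HasJointEmbedding C)
    (hcoh : ConcreteAccessible.IsCoherent U)
    (hmono : ConcreteAccessible.MorphismsAreConcreteMonos U) :
    ∃ κ₀ : Cardinal.{w}, ∀ (κ : Cardinal.{w}) [Fact κ.IsRegular], κ₀ ≤ κ →
      ∀ K : C, ConcreteAccessible.IsGaloisSaturated U κ K ↔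
        ConcreteAccessible.IsSaturated κ K := by
  obtain ⟨κ₀, h⟩ := ConcreteAccessible.exists_forall_hasSmallHulls U
  refine ⟨κ₀, fun κ _ hκ K ↦ ?_⟩
  have hU := h κ hκ
  have hsmall (A : C) (_ : IsCardinalPresentable A κ) : HasCardinalLT (U.obj A) κ :=
    hU.hasCardinalLT_of_isCardinalPresentable hcoh hmono A
  exact ⟨fun hK ↦ hK.isSaturated hcoh hmono hU hsmall,
    fun hK ↦ hK.isGaloisSaturated hAP hcoh hU hsmall⟩
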